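/- Write $(a;q)_n=\prod_{j=0}^{n-1}(1-aq^j)$ and $(a;q)_\infty=\prod_{j=0}^{\infty}(1-aq^j)$. All identities are identities of formal power series in $\mathbb{Z}[[q]]$, where infinite sums and products are taken with respect to coefficientwise convergence; every series below converges unconditionally in this sense. For every integer $k\ge 1$, $$(q;q)_\infty\sum_{i=0}^{\infty}\frac{q^{i}}{(q;q)_i^{\,k+1}}=\sum_{i_1=0}^{\infty}\cdots\sum_{i_k=0}^{\infty}\frac{q^{\,\sum_{j=1}^{k}(i_j+i_j^2)+\sum_{s=2}^{k}\sum_{j=s}^{k}i_{s-1}i_j}}{\prod_{j=1}^{k}\left((q;q)_{i_j}\,(q;q)_{i_1+\cdots+i_j}\right)}.$$ In particular (the case $k=1$, multiplied by $(q;q)_\infty$), Ramanujan's false theta function identity holds: $$(q;q)_\infty^2\sum_{i=0}^{\infty}\frac{q^{i}}{(q;q)_i^{2}}=(q;q)_\infty\sum_{i=0}^{\infty}\frac{q^{\,i^2+i}}{(q;q)_i^{2}}.$$ -/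

import Mathlib

open scoped PowerSeries PowerSeries.WithPiTopology

/-- The finite `q`-Pochhammer symbol `(a;q)_n = ∏_{j=0}^{n-1} (1 - a q^j)`. -/
def qPochhammer {R : Type*} [CommRing R] (a q : R) (n : ℕ) : R :=
  ∏ j ∈ Finset.range n, (1 - a * q ^ j)

/-- The infinite `q`-Pochhammer symbol `(a;q)_∞ = ∏_{j=0}^∞ (1 - a q^j)`. -/
noncomputable def qPochhammerInf {R : Type*} [CommRing R] [TopologicalSpace R] (a q : R) : R :=
  ∏' j : ℕ, (1 - a * q ^ j)

/-- The formal variable `q` of the ring `ℤ⟦q⟧` of formal power series with integer coefficients.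
This ring carries the topology of coefficientwise convergence, `ℤ` being discrete. -/
noncomputable def qVar : ℤ⟦X⟧ := PowerSeries.X

/-- `(q;q)_n` has constant coefficient `1`, so it is invertible in `ℤ⟦q⟧`, and the
`Ring.inverse` of it (or of a product of such factors) is the genuine inverse. -/
theorem isUnit_qPochhammer_qVar (n : ℕ) : IsUnit (qPochhammer qVar qVar n) := by
  rw [PowerSeries.isUnit_iff_constantCoeff]
  simp [qPochhammer, qVar]

/-- The infinite product `(q;q)_∞` converges in `ℤ⟦q⟧`. -/
theorem multipliable_one_sub_qVar : Multipliable fun j : ℕ => 1 - qVar * qVar ^ j := by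
  simpa only [qVar, pow_succ'] using PowerSeries.WithPiTopology.multipliable_one_sub_X_pow ℤ

/-- The general term `q^i / (q;q)_i^m` of the single sum. -/
noncomputable def singleTerm (m i : ℕ) : ℤ⟦X⟧ :=
  qVar ^ i * Ring.inverse (qPochhammer qVar qVar i ^ m)

/-- The exponent `∑_{j=1}^k (i_j + i_j^2) + ∑_{s=2}^k ∑_{j=s}^k i_{s-1} i_j`; the double sum runs
over all pairs of positions `s - 1 < j`. The tuple `(i_1, …, i_k)` is indexed by `Fin k`. -/
def multiExponent {k : ℕ} (i : Fin k → ℕ) : ℕ :=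
  ∑ j, (i j + i j ^ 2) + ∑ s, ∑ j ∈ Finset.Ioi s, i s * i j

/-- The denominator `∏_{j=1}^k (q;q)_{i_j} (q;q)_{i_1 + ⋯ + i_j}`. -/
noncomputable def multiDenominator {k : ℕ} (i : Fin k → ℕ) : ℤ⟦X⟧ :=
  ∏ j, (qPochhammer qVar qVar (i j) * qPochhammer qVar qVar (∑ s ∈ Finset.Iic j, i s))

/-- The denominator is invertible in `ℤ⟦q⟧`, so its `Ring.inverse` is the genuine inverse. -/
theorem isUnit_multiDenominator {k : ℕ} (i : Fin k → ℕ) : IsUnit (multiDenominator i) := by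
  unfold multiDenominator
  refine Finset.prod_induction _ IsUnit (fun _ _ => IsUnit.mul) isUnit_one fun j _ => ?_
  exact (isUnit_qPochhammer_qVar _).mul (isUnit_qPochhammer_qVar _)

/-- The general term of the `k`-fold sum. -/
noncomputable def multiTerm {k : ℕ} (i : Fin k → ℕ) : ℤ⟦X⟧ :=
  qVar ^ multiExponent i * Ring.inverse (multiDenominator i)

/-! Generalise by a shift N: the k-fold sum with every partial sum raised by N equals (q;q)_∞ ∑ q^n
/ ((q;q)_n (q;q)_{N+n}^k), and N = 0 is the claim. Induct on k (`tsum_shiftedTerm`). Euler's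
identity is k = 0. Fixing the first index i leaves a (k-1)-fold sum of shift N + i; grouping the
resulting double sum by m = i + n, the finite identity `sum_antidiagonal_invPochhammer` evaluates
each group. -/

open PowerSeries in
/-- A family of power series, the `i`-th of which is divisible by `q ^ e i`, is summable as soon as
only finitely many `e i` lie below any given bound. -/
theorem summable_of_qVar_pow_dvd {ι : Type*} {f : ι → ℤ⟦X⟧} (e : ι → ℕ)
    (he : ∀ d, {i | e i ≤ d}.Finite) (hf : ∀ i, qVar ^ e i ∣ f i) : Summable f := by
  rw [PowerSeries.WithPiTopology.summable_iff_summable_coeff]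
  intro d
  refine summable_of_hasFiniteSupport ((he d).subset fun i hi => ?_)
  by_contra h
  exact hi (X_pow_dvd_iff.1 (hf i) d (not_le.1 h))

theorem finite_setOf_sum_le {k : ℕ} (d : ℕ) : {t : Fin k → ℕ | ∑ j, t j ≤ d}.Finite := by
  refine (Set.finite_Iic (fun _ : Fin k => d)).subset fun t ht j => ?_
  exact (Finset.single_le_sum (fun _ _ => Nat.zero_le _) (Finset.mem_univ j)).trans ht

theorem finite_setOf_add_le (d : ℕ) : {p : ℕ × ℕ | p.1 + p.2 ≤ d}.Finite := by
  refine (Set.finite_Iic (d, d)).subset fun p hp => ?_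
  simp only [Set.mem_ofPred_eq] at hp
  exact Prod.mk_le_mk.2 ⟨by lia, by lia⟩

/-! ### Inverse Pochhammer symbols; the q-Vandermonde and Euler identities -/

/-- The inverse of `(q;q)_n` in `ℤ⟦q⟧`. -/
noncomputable def invPochhammer (n : ℕ) : ℤ⟦X⟧ :=
  Ring.inverse (qPochhammer qVar qVar n)

theorem qPochhammer_mul_invPochhammer (n : ℕ) :
    qPochhammer qVar qVar n * invPochhammer n = 1 :=
  Ring.mul_inverse_cancel _ (isUnit_qPochhammer_qVar n)

theorem ringInverse_eq_of_mul_eq_one {R : Type*} [CommRing R] {a b : R} (h : a * b = 1) :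
    Ring.inverse a = b := by
  have ha : IsUnit a := IsUnit.of_mul_eq_one b h
  have := Ring.inverse_mul_cancel a ha
  linear_combination b * this - Ring.inverse a * h

theorem invPochhammer_zero : invPochhammer 0 = 1 := by
  simp [invPochhammer, qPochhammer]

theorem invPochhammer_succ_mul (n : ℕ) :
    invPochhammer (n + 1) * (1 - qVar ^ (n + 1)) = invPochhammer n := by
  have h := qPochhammer_mul_invPochhammer n
  have h' := qPochhammer_mul_invPochhammer (n + 1)
  have hs : qPochhammer qVar qVar (n + 1) =
      qPochhammer qVar qVar n * (1 - qVar ^ (n + 1)) := by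
    simp only [qPochhammer, Finset.prod_range_succ, pow_succ']
  rw [hs] at h'
  linear_combination invPochhammer n * h' - invPochhammer (n + 1) * (1 - qVar ^ (n + 1)) * h

/-- A limiting case of the `q`-Vandermonde summation. -/
theorem sum_antidiagonal_invPochhammer (m N : ℕ) :
    ∑ p ∈ Finset.HasAntidiagonal.antidiagonal m, qVar ^ (p.1 ^ 2 + N * p.1) * invPochhammer (N + p.1) *
        (invPochhammer p.1 * invPochhammer p.2) =
      invPochhammer m * invPochhammer (N + m) := by
  induction m generalizing N with
  | zero => simp [invPochhammer_zero]
  | succ m ih =>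
    set g : ℕ → ℤ⟦X⟧ := fun i => qVar ^ (i ^ 2 + N * i) * invPochhammer (N + i) with hg
    have key : (∑ p ∈ Finset.HasAntidiagonal.antidiagonal (m + 1),
        g p.1 * (invPochhammer p.1 * invPochhammer p.2)) * (1 - qVar ^ (m + 1)) =
        invPochhammer m * invPochhammer (N + 1 + m) := by
      -- For a + b = m + 1, write 1 - q^(m+1) = q^a (1 - q^b) + (1 - q^a): each piece lowers one
      -- Pochhammer index, and together they give the sum for m with shift N + 1.
      have hsplit : (∑ p ∈ Finset.HasAntidiagonal.antidiagonal (m + 1),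
          g p.1 * (invPochhammer p.1 * invPochhammer p.2)) * (1 - qVar ^ (m + 1)) =
          ∑ p ∈ Finset.HasAntidiagonal.antidiagonal (m + 1), g p.1 * qVar ^ p.1 * invPochhammer p.1 *
            (invPochhammer p.2 * (1 - qVar ^ p.2)) +
          ∑ p ∈ Finset.HasAntidiagonal.antidiagonal (m + 1), g p.1 * (invPochhammer p.1 * (1 - qVar ^ p.1)) *
            invPochhammer p.2 := by
        rw [Finset.sum_mul, ← Finset.sum_add_distrib]
        refine Finset.sum_congr rfl fun p hp => ?_
        rw [← Finset.HasAntidiagonal.mem_antidiagonal.1 hp, pow_add]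
        ring
      rw [hsplit, Finset.Nat.antidiagonal_succ', Finset.sum_cons, Finset.sum_map,
        ← Finset.Nat.antidiagonal_succ', Finset.Nat.antidiagonal_succ, Finset.sum_cons,
        Finset.sum_map]
      simp only [Function.Embedding.prodMap, Function.Embedding.coeFn_mk, Prod.map,
        Function.Embedding.refl_apply, pow_zero, sub_self, mul_zero, zero_mul, zero_add,
        Nat.succ_eq_add_one, invPochhammer_succ_mul]
      rw [← ih (N + 1), ← Finset.sum_add_distrib]
      refine Finset.sum_congr rfl fun p _ => ?_
      simp only [hg]
      rw [← invPochhammer_succ_mul (N + p.1), show N + 1 + p.1 = N + p.1 + 1 by ring,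
        show N + (p.1 + 1) = N + p.1 + 1 by ring]
      ring
    have hs := invPochhammer_succ_mul m
    have h := qPochhammer_mul_invPochhammer m
    rw [show N + (m + 1) = N + 1 + m by ring]
    have hu : (1 - qVar ^ (m + 1)) * (invPochhammer (m + 1) * qPochhammer qVar qVar m) = 1 := by
      linear_combination h + qPochhammer qVar qVar m * hs
    linear_combination invPochhammer (m + 1) * qPochhammer qVar qVar m * key +
      (invPochhammer (m + 1) * invPochhammer (N + 1 + m)) * h -
      (∑ p ∈ Finset.HasAntidiagonal.antidiagonal (m + 1),
        g p.1 * (invPochhammer p.1 * invPochhammer p.2)) * hu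

theorem summable_qVar_pow_mul (c : ℕ → ℤ⟦X⟧) : Summable fun n => qVar ^ n * c n :=
  summable_of_qVar_pow_dvd (fun n => n) (fun d => Set.finite_Iic d) fun _ => dvd_mul_right _ _

theorem tendsto_qPochhammer :
    Filter.Tendsto (fun n => qPochhammer qVar qVar n) Filter.atTop
      (nhds (qPochhammerInf qVar qVar)) :=
  multipliable_one_sub_qVar.hasProd.tendsto_prod_nat

/-- Euler's identity `∑ q^n / (q;q)_n = 1 / (q;q)_∞`. -/
theorem qPochhammerInf_mul_tsum :
    qPochhammerInf qVar qVar * ∑' n, qVar ^ n * invPochhammer n = 1 := by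
  -- The partial sums telescope, so (q;q)_n times the sum up to n is constantly 1.
  have hfin : ∀ n, ∑ i ∈ Finset.range (n + 1), qVar ^ i * invPochhammer i = invPochhammer n := by
    intro n
    induction n with
    | zero => simp [invPochhammer_zero]
    | succ n ih =>
      rw [Finset.sum_range_succ, ih]
      linear_combination -invPochhammer_succ_mul n
  have h1 := (summable_qVar_pow_mul invPochhammer).hasSum.tendsto_sum_nat
  have h2 := (tendsto_qPochhammer.mul (h1.comp (Filter.tendsto_add_atTop_nat 1)))
  refine tendsto_nhds_unique h2 ?_
  simp only [Function.comp_apply, hfin, qPochhammer_mul_invPochhammer]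
  exact tendsto_const_nhds

/-! ### The shifted multiple sum -/

/-- The general term of the `k`-fold sum, with all partial sums shifted by `N`. -/
noncomputable def shiftedTerm {k : ℕ} (N : ℕ) (t : Fin k → ℕ) : ℤ⟦X⟧ :=
  qVar ^ (multiExponent t + N * ∑ j, t j) *
    ∏ j, (invPochhammer (t j) * invPochhammer (N + ∑ s ∈ Finset.Iic j, t s))

theorem shiftedTerm_zero {k : ℕ} (t : Fin k → ℕ) : shiftedTerm 0 t = multiTerm t := by
  unfold shiftedTerm multiTerm
  congr 1
  · simp
  · refine (ringInverse_eq_of_mul_eq_one ?_).symm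
    rw [multiDenominator, ← Finset.prod_mul_distrib]
    refine Finset.prod_eq_one fun j _ => ?_
    rw [zero_add, mul_mul_mul_comm, qPochhammer_mul_invPochhammer,
      qPochhammer_mul_invPochhammer, one_mul]

theorem multiExponent_cons {k : ℕ} (i : ℕ) (t : Fin k → ℕ) :
    multiExponent (Fin.cons i t : Fin (k + 1) → ℕ) =
      i ^ 2 + i + (multiExponent t + i * ∑ j, t j) := by
  simp only [multiExponent, Fin.sum_univ_succ, Fin.sum_Ioi_zero, Fin.sum_Ioi_succ, Fin.cons_zero,
    Fin.cons_succ, Finset.mul_sum]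
  ring

theorem sum_Iic_succ_cons {k : ℕ} (i : ℕ) (t : Fin k → ℕ) (j : Fin k) :
    ∑ s ∈ Finset.Iic j.succ, (Fin.cons i t : Fin (k + 1) → ℕ) s =
      i + ∑ s ∈ Finset.Iic j, t s := by
  have h : ∀ (n : ℕ) (a : Fin n) (f : Fin n → ℕ),
      ∑ s ∈ Finset.Iic a, f s = ∑ s, if s ≤ a then f s else 0 := by
    intro n a f
    rw [← Finset.sum_filter]
    congr 1
    ext
    simp
  rw [h, h, Fin.sum_univ_succ]
  simp

/-- The head i enters the tail only through its cross terms and the partial sums, and both are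
absorbed by the shift N + i. -/
theorem shiftedTerm_cons {k : ℕ} (N i : ℕ) (t : Fin k → ℕ) :
    shiftedTerm N (Fin.cons i t : Fin (k + 1) → ℕ) =
      qVar ^ (i ^ 2 + i + N * i) * (invPochhammer i * invPochhammer (N + i)) *
        shiftedTerm (N + i) t := by
  have h0 : ∑ s ∈ Finset.Iic (0 : Fin (k + 1)), (Fin.cons i t : Fin (k + 1) → ℕ) s = i := by
    have : Finset.Iic (0 : Fin (k + 1)) = {0} := by ext; simp
    rw [this, Finset.sum_singleton, Fin.cons_zero]
  simp only [shiftedTerm, multiExponent_cons, Fin.prod_univ_succ, h0, sum_Iic_succ_cons,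
    Fin.sum_univ_succ, Fin.cons_zero, Fin.cons_succ, add_assoc]
  ring

theorem summable_shiftedTerm {k : ℕ} (N : ℕ) : Summable fun t : Fin k → ℕ => shiftedTerm N t := by
  refine summable_of_qVar_pow_dvd (fun t => ∑ j, t j) finite_setOf_sum_le fun t => ?_
  refine (pow_dvd_pow _ ?_).trans (dvd_mul_right _ _)
  refine le_add_right (le_add_right (Finset.sum_le_sum fun j _ => Nat.le_add_right _ _))

/-- Summation over `ℕ × ℕ` along antidiagonals. -/
theorem Summable.tsum_prod_eq_tsum_sum_antidiagonal {f : ℕ × ℕ → ℤ⟦X⟧} (hf : Summable f) :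
    ∑' p, f p = ∑' n, ∑ p ∈ Finset.HasAntidiagonal.antidiagonal n, f p := by
  rw [← Finset.HasAntidiagonal.sigmaAntidiagonalEquivProd.tsum_eq f]
  refine (Summable.tsum_sigma' (fun n => (hasSum_fintype _).summable)
    (Finset.HasAntidiagonal.sigmaAntidiagonalEquivProd.summable_iff.2 hf)).trans ?_
  refine tsum_congr fun n => ?_
  rw [tsum_fintype]
  exact Finset.sum_coe_sort _ f

/-- The `k`-fold sum with partial sums shifted by `N`, as a single sum. -/
theorem tsum_shiftedTerm (k N : ℕ) :
    ∑' t : Fin k → ℕ, shiftedTerm N t =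
      qPochhammerInf qVar qVar *
        ∑' n, qVar ^ n * (invPochhammer n * invPochhammer (N + n) ^ k) := by
  induction k generalizing N with
  | zero =>
    simp only [pow_zero, mul_one, qPochhammerInf_mul_tsum]
    rw [tsum_fintype]
    simp [shiftedTerm, multiExponent]
  | succ k ih =>
    obtain ⟨e, he⟩ : ∃ e : ℕ × (Fin k → ℕ) ≃ (Fin (k + 1) → ℕ), ∀ i t, e (i, t) = Fin.cons i t :=
      ⟨Fin.consEquiv fun _ => ℕ, fun _ _ => rfl⟩
    have hS : Summable fun p => shiftedTerm N (e p) :=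
      (summable_shiftedTerm (k := k + 1) N).comp_injective e.injective
    have hS' : ∑' t : Fin (k + 1) → ℕ, shiftedTerm N t = ∑' p, shiftedTerm N (e p) :=
      (e.tsum_eq _).symm
    have hsum : ∀ i, Summable fun t : Fin k → ℕ => shiftedTerm N (e (i, t)) :=
      fun i => by
        simp only [he, shiftedTerm_cons]
        exact (summable_shiftedTerm _).mul_left _
    set F : ℕ × ℕ → ℤ⟦X⟧ := fun p =>
      qVar ^ (p.1 ^ 2 + p.1 + N * p.1) * (invPochhammer p.1 * invPochhammer (N + p.1)) *
        (qVar ^ p.2 * (invPochhammer p.2 * invPochhammer (N + p.1 + p.2) ^ k)) with hF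
    have hFs : Summable F := by
      refine summable_of_qVar_pow_dvd (fun p => p.1 + p.2) finite_setOf_add_le fun p => ?_
      rw [pow_add]
      exact mul_dvd_mul (((pow_dvd_pow _ (by lia)).trans (dvd_mul_right _ _)))
        (dvd_mul_right _ _)
    rw [hS', hS.tsum_prod' hsum]
    simp only [he, shiftedTerm_cons]
    have hinner : ∀ i, ∑' t : Fin k → ℕ,
        qVar ^ (i ^ 2 + i + N * i) * (invPochhammer i * invPochhammer (N + i)) *
          shiftedTerm (N + i) t = qPochhammerInf qVar qVar * ∑' n, F (i, n) := by
      intro i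
      rw [(summable_shiftedTerm _).tsum_mul_left, ih, mul_left_comm,
        ← (summable_qVar_pow_mul _).tsum_mul_left]
    have hFi : ∀ i, Summable fun n => F (i, n) := fun i =>
      (summable_qVar_pow_mul fun n => invPochhammer n * invPochhammer (N + i + n) ^ k).mul_left
        (qVar ^ (i ^ 2 + i + N * i) * (invPochhammer i * invPochhammer (N + i)))
    have hFo : Summable fun i => ∑' n, F (i, n) :=
      (hFs.hasSum.prod_fiberwise fun i => (hFi i).hasSum).summable
    rw [tsum_congr hinner, hFo.tsum_mul_left, ← hFs.tsum_prod' hFi,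
      hFs.tsum_prod_eq_tsum_sum_antidiagonal]
    congr 1
    -- On i + n = m the factor (q;q)_{N+m}^{-k} is constant and the exponent is m + i^2 + N i, so
    -- q-Vandermonde applies and supplies one more 1/(q;q)_{N+m}.
    refine tsum_congr fun m => ?_
    rw [pow_succ', ← mul_assoc (invPochhammer m), ← sum_antidiagonal_invPochhammer m N,
      Finset.sum_mul, Finset.mul_sum]
    refine Finset.sum_congr rfl fun p hp => ?_
    rw [← Finset.HasAntidiagonal.mem_antidiagonal.1 hp]
    simp only [hF, ← add_assoc]
    ring

/-! ### Specialisation to shift zero -/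

theorem singleTerm_succ (k i : ℕ) :
    singleTerm (k + 1) i = qVar ^ i * (invPochhammer i * invPochhammer (0 + i) ^ k) := by
  rw [singleTerm, zero_add, ← pow_succ']
  congr 1
  exact ringInverse_eq_of_mul_eq_one
    (by rw [← mul_pow, qPochhammer_mul_invPochhammer, one_pow])

theorem summable_singleTerm (m : ℕ) : Summable fun i => singleTerm m i :=
  summable_qVar_pow_mul _

theorem summable_multiTerm (k : ℕ) : Summable fun i : Fin k → ℕ => multiTerm i := by
  simpa only [shiftedTerm_zero] using summable_shiftedTerm (k := k) 0

theorem qPochhammerInf_mul_tsum_singleTerm (k : ℕ) :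
    qPochhammerInf qVar qVar * ∑' i : ℕ, singleTerm (k + 1) i =
      ∑' i : Fin k → ℕ, multiTerm i := by
  simp only [singleTerm_succ, ← shiftedTerm_zero, tsum_shiftedTerm]

theorem multiTerm_fin_one (i : ℕ) :
    multiTerm (fun _ : Fin 1 => i) =
      qVar ^ (i ^ 2 + i) * Ring.inverse (qPochhammer qVar qVar i ^ 2) := by
  simp [multiTerm, multiExponent, multiDenominator, add_comm, sq]

theorem mainTheorem4 :
    (∀ k : ℕ, 1 ≤ k →
      Summable (fun i : ℕ => singleTerm (k + 1) i) ∧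
      Summable (fun i : Fin k → ℕ => multiTerm i) ∧
      qPochhammerInf qVar qVar * ∑' i : ℕ, singleTerm (k + 1) i =
        ∑' i : Fin k → ℕ, multiTerm i) ∧
    (Summable (fun i : ℕ => qVar ^ (i ^ 2 + i) * Ring.inverse (qPochhammer qVar qVar i ^ 2)) ∧
      qPochhammerInf qVar qVar ^ 2 *
          ∑' i : ℕ, qVar ^ i * Ring.inverse (qPochhammer qVar qVar i ^ 2) =
        qPochhammerInf qVar qVar *
          ∑' i : ℕ, qVar ^ (i ^ 2 + i) * Ring.inverse (qPochhammer qVar qVar i ^ 2)) := by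
  refine ⟨fun k _ => ⟨summable_singleTerm _, summable_multiTerm k,
    qPochhammerInf_mul_tsum_singleTerm k⟩, ?_, ?_⟩
  · refine summable_of_qVar_pow_dvd (fun i => i) (fun d => Set.finite_Iic d) fun i => ?_
    exact (pow_dvd_pow _ (Nat.le_add_left _ _)).trans (dvd_mul_right _ _)
  · have h := qPochhammerInf_mul_tsum_singleTerm 1
    rw [← (Equiv.funUnique (Fin 1) ℕ).symm.tsum_eq] at h
    rw [sq, mul_assoc]
    congr 1
    refine h.trans (tsum_congr fun i => ?_)
    exact multiTerm_fin_one i
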